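/- Permutations $\pi\in S_n$ are written in one-line notation $\pi_1\cdots\pi_n$. Let $\mathrm{inv}(\pi)$ be the number of pairs $i<j$ with $\pi_i>\pi_j$, let $\mathrm{Av}_n(B)$ be the set of $\pi\in S_n$ that avoid every pattern in $B$, and let $\mathrm{av}_n^k(B)$ be the number of $\pi\in\mathrm{Av}_n(B)$ with $\mathrm{inv}(\pi)=k$. For a value $e$, let $\pi\smallsetminus e$ be the permutation order-isomorphic to the sequence obtained from $\pi$ by removing the entry $e$. Let $\mathrm{id}_m$ be the identity of length $m\ge 0$ and $\pi^{\mathrm{rc}}$ the reverse-complement, $\pi^{\mathrm{rc}}_i=n+1-\pi_{n+1-i}$. A permutation is decomposable if it is a direct sum $\sigma\oplus\tau$ of two nonempty permutations, and indecomposable otherwise; $\pi\in S_n$ is almost decomposable if it is indecomposable but $\pi\smallsetminus e$ is decomposable for some $e\in\{1,\pi_1,n,\pi_n\}$. Every decomposable $1324$-avoiding permutation can be written uniquely as $\pi=\sigma\oplus\mathrm{id}_m\oplus\tau$ with $m\ge 0$ and $\sigma,\tau$ nonempty and indecomposable; put $\widetilde f(\pi)=\sigma\oplus\mathrm{id}_{m+1}\oplus\tau$.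 For a $1324$-avoiding permutation $\pi\in S_n$ that is decomposable or almost decomposable, define $f(\pi)\in S_{n+1}$ as follows. If $\pi$ is decomposable, $f(\pi)=\widetilde f(\pi)$. If $\pi$ is almost decomposable, then: 1. if $\pi\smallsetminus\pi_1$ is decomposable, $f(\pi)$ is the permutation with $f(\pi)_1=\pi_1$ and $f(\pi)\smallsetminus\pi_1=\widetilde f(\pi\smallsetminus\pi_1)$; 2. otherwise, if $\pi\smallsetminus 1$ is decomposable, $f(\pi)=f(\pi^{-1})^{-1}$; 3. otherwise, $f(\pi)=f(\pi^{\mathrm{rc}})^{\mathrm{rc}}$. **Theorem.** If $\pi\in\mathrm{Av}_n(1324,1342)$ is decomposable or almost decomposable and $\mathrm{inv}(\pi)\le 2n-6$, then $f(\pi)$ avoids $1342$. Moreover, for all integers $k\ge 0$ and $n\ge\frac{k+7}{2}$, $$\mathrm{av}_n^k(1324,1342)\le\mathrm{av}_{n+1}^k(1324,1342).$$ -/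

import Mathlib

namespace PermPattern

open Equiv

/-! Permutations of length `n` are elements of `Perm (Fin n)`; positions and values are numbered
from `0`, so the paper-style entry `v` at position `i` becomes `v - 1` at position `i - 1`. -/

/-- `π` contains the pattern `p`: some subsequence of `π` is order-isomorphic to `p`. -/
def Contains {m n : ℕ} (p : Perm (Fin m)) (π : Perm (Fin n)) : Prop :=
  ∃ g : Fin m ↪o Fin n, ∀ i j, π (g i) < π (g j) ↔ p i < p j

/-- `π` avoids the pattern `p`. -/
def Avoids {m n : ℕ} (p : Perm (Fin m)) (π : Perm (Fin n)) : Prop :=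
  ¬ Contains p π

/-- The pattern `1324`. -/
def p1324 : Perm (Fin 4) where
  toFun := ![0, 2, 1, 3]
  invFun := ![0, 2, 1, 3]
  left_inv := by decide
  right_inv := by decide

/-- The pattern `1342`. -/
def p1342 : Perm (Fin 4) where
  toFun := ![0, 2, 3, 1]
  invFun := ![0, 3, 1, 2]
  left_inv := by decide
  right_inv := by decide

/-- The number of inversions: pairs of positions `i < j` with `π i > π j`. -/
def inv {n : ℕ} (π : Perm (Fin n)) : ℕ :=
  (Finset.univ.filter fun ij : Fin n × Fin n => ij.1 < ij.2 ∧ π ij.2 < π ij.1).card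

/-- `Av n B`: the permutations of length `n` that avoid every pattern in `B`. -/
def Av (n : ℕ) (B : Set (Σ m, Perm (Fin m))) : Set (Perm (Fin n)) :=
  {π | ∀ p ∈ B, Avoids p.2 π}

/-- `av n k B`: the number of `B`-avoiding permutations of length `n` with exactly `k`
inversions. -/
noncomputable def av (n k : ℕ) (B : Set (Σ m, Perm (Fin m))) : ℕ :=
  {π : Perm (Fin n) | π ∈ Av n B ∧ inv π = k}.ncard

/-- The set of patterns `{1324, 1342}`. -/
def B1324_1342 : Set (Σ m, Perm (Fin m)) := {⟨4, p1324⟩, ⟨4, p1342⟩}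

/-- Transport of a permutation along an equality of lengths. -/
def castLen {m n : ℕ} (h : m = n) (π : Perm (Fin m)) : Perm (Fin n) :=
  (finCongr h).permCongr π

/-- The direct sum `σ ⊕ τ`. -/
def dsum {m n : ℕ} (σ : Perm (Fin m)) (τ : Perm (Fin n)) : Perm (Fin (m + n)) :=
  finSumFinEquiv.permCongr (Equiv.sumCongr σ τ)

/-- `π` is a direct sum of two nonempty permutations. -/
def Decomposable {n : ℕ} (π : Perm (Fin n)) : Prop :=
  ∃ (a b : ℕ) (σ : Perm (Fin a)) (τ : Perm (Fin b)) (h : a + b = n),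
    0 < a ∧ 0 < b ∧ π = castLen h (dsum σ τ)

/-- `π ∖ e`: delete the entry with value `e` from the one-line notation of `π`, and
standardize. -/
def delete {n : ℕ} (π : Perm (Fin (n + 1))) (e : Fin (n + 1)) : Perm (Fin n) :=
  (finSuccAboveEquiv (π.symm e)).trans
    ((π.subtypeEquiv fun _ => not_congr π.eq_symm_apply).trans (finSuccAboveEquiv e).symm)

theorem succAbove_delete {n : ℕ} (π : Perm (Fin (n + 1))) (e : Fin (n + 1)) (j : Fin n) :
    e.succAbove (delete π e j) = π ((π.symm e).succAbove j) := by
  have h := congrArg Subtype.val ((finSuccAboveEquiv e).apply_symm_apply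
    ((π.subtypeEquiv fun _ => not_congr π.eq_symm_apply) (finSuccAboveEquiv (π.symm e) j)))
  simp only [finSuccAboveEquiv_apply] at h
  exact h

/-- The permutation `ρ` with `ρ i = v` and `ρ ∖ v = σ`. -/
def insertEntry {n : ℕ} (σ : Perm (Fin n)) (i v : Fin (n + 1)) : Perm (Fin (n + 1)) :=
  (finSuccEquiv' i).trans ((optionCongr σ).trans (finSuccEquiv' v).symm)

theorem insertEntry_self {n : ℕ} (σ : Perm (Fin n)) (i v : Fin (n + 1)) :
    insertEntry σ i v i = v := by
  simp [insertEntry]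

theorem insertEntry_succAbove {n : ℕ} (σ : Perm (Fin n)) (i v : Fin (n + 1)) (j : Fin n) :
    insertEntry σ i v (i.succAbove j) = v.succAbove (σ j) := by
  simp [insertEntry]

theorem delete_insertEntry {n : ℕ} (σ : Perm (Fin n)) (i v : Fin (n + 1)) :
    delete (insertEntry σ i v) v = σ := by
  have h : (insertEntry σ i v).symm v = i := by
    rw [Equiv.symm_apply_eq, insertEntry_self]
  ext1 j
  apply Fin.succAbove_right_injective (p := v)
  rw [succAbove_delete, h, insertEntry_succAbove]

/-- `π` is almost decomposable: it is indecomposable, but deleting one of the entries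
`1, π₁, n, πₙ` yields a decomposable permutation. -/
def AlmostDecomposable : {n : ℕ} → Perm (Fin n) → Prop
  | 0, _ => False
  | n + 1, π => ¬ Decomposable π ∧
      ∃ e ∈ ({0, π 0, Fin.last n, π (Fin.last n)} : Set (Fin (n + 1))),
        Decomposable (delete π e)

/-- The reverse-complement. -/
def revCompl {n : ℕ} (π : Perm (Fin n)) : Perm (Fin n) :=
  Fin.revPerm * π * Fin.revPerm

/-- `π = σ ⊕ id_m ⊕ τ` and `ρ = σ ⊕ id_{m+1} ⊕ τ` for some `m ≥ 0` and some nonempty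
indecomposable `σ`, `τ`. -/
def IsFTilde {n : ℕ} (π : Perm (Fin n)) (ρ : Perm (Fin (n + 1))) : Prop :=
  ∃ (a m b : ℕ) (σ : Perm (Fin a)) (τ : Perm (Fin b))
    (h : a + m + b = n) (h' : a + (m + 1) + b = n + 1),
    0 < a ∧ 0 < b ∧ ¬ Decomposable σ ∧ ¬ Decomposable τ ∧
      π = castLen h (dsum (dsum σ (1 : Perm (Fin m))) τ) ∧
      ρ = castLen h' (dsum (dsum σ (1 : Perm (Fin (m + 1)))) τ)

open Classical in
/-- The map `σ ⊕ id_m ⊕ τ ↦ σ ⊕ id_{m+1} ⊕ τ`, where `σ` and `τ` are nonempty and indecomposable.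
Every decomposable `1324`-avoider has this form, in a unique way; the value is irrelevant for
permutations not of this form. -/
noncomputable def fTilde {n : ℕ} (π : Perm (Fin n)) : Perm (Fin (n + 1)) :=
  if h : ∃ ρ, IsFTilde π ρ then h.choose else 1

/-- The first case: the permutation `ρ` with `ρ₁ = π₁` and `ρ ∖ π₁ = fTilde (π ∖ π₁)`. -/
noncomputable def fFirst {n : ℕ} (π : Perm (Fin (n + 1))) : Perm (Fin (n + 2)) :=
  insertEntry (fTilde (delete π (π 0))) 0 (π 0).castSucc

open Classical in
/-- The first two cases: `fFirst π` if `π ∖ π₁` is decomposable, and otherwise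
(used when `π ∖ 1` is decomposable, that is, when the first case applies to `π⁻¹`)
the inverse of `fFirst π⁻¹`. -/
noncomputable def fFirstTwo {n : ℕ} (π : Perm (Fin (n + 1))) : Perm (Fin (n + 2)) :=
  if Decomposable (delete π (π 0)) then fFirst π else (fFirst π⁻¹)⁻¹

open Classical in
/-- The Linusson--Verkama map `f`, meaningful for `1324`-avoiders that are decomposable or almost
decomposable: `fTilde` on decomposable permutations; the first two cases if `π ∖ π₁` or `π ∖ 1` is
decomposable; and otherwise `f (π^rc)^rc`, where one of the first two cases applies to `π^rc`. -/
noncomputable def f : {n : ℕ} → Perm (Fin n) → Perm (Fin (n + 1))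
  | 0, _ => 1
  | _ + 1, π =>
    if Decomposable π then fTilde π
    else if Decomposable (delete π (π 0)) ∨ Decomposable (delete π 0) then fFirstTwo π
    else revCompl (fFirstTwo (revCompl π))

end PermPattern

/-! The first claim rests on cuts, positions c at which the first c entries are the c smallest
values. The map `fTilde` inserts a fixed point at a cut. Such a point lies in no inversion, so in a
copy of 1342 it can only be the 1; then a 231 lies behind the cut and, together with the first
entry, already forms 1342 (`avoids_p1342_insert_fixed`).

If π is almost decomposable, the deleted boundary entry must cross the cut, since otherwise π would
be decomposable. A first or smallest entry can only play the 1, which again puts a 231 behind the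
cut; a largest entry can only play the 4, which puts a 132 in front of the cut and hence a 1324 in
π. The last entry is the only dangerous one. If only the rule for it applied, avoidance of 1342
would force so rigid a block structure that inv π > 2n - 6 (`lt_inv_insertEntry_last`).

The monotonicity in n is proved separately, by a recursion on the first entry rather than through f.
Let F(n, c) be the generating function by inversions of the avoiders whose entries ≥ c avoid 213 and
231. Removing the first entry gives F(n+1, c) = Σ_{i ≤ c} q^i F(n, i) + q^n F(n, c) for c < n, and
the sum over i ≤ n alone for c ≥ n. Induction yields (1 + q^(n+1)) F(n+1, c) ≤ F(n+2, c)
coefficientwise for c ≤ n + 1 (`avAbove_add_le`); c = n + 1 is the desired inequality. -/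

namespace PermPattern

open Equiv

/-! ### Patterns of length four -/

theorem contains_of_strictMono {m n : ℕ} {p : Perm (Fin m)} {π : Perm (Fin n)} (g : Fin m → Fin n)
    (hg : StrictMono g) (h : ∀ i j, p i < p j → π (g i) < π (g j)) : Contains p π := by
  refine ⟨OrderEmbedding.ofStrictMono g hg, fun i j => ⟨fun hij => ?_, h i j⟩⟩
  rcases lt_trichotomy (p i) (p j) with h1 | h1 | h1
  · exact h1
  · rw [p.injective h1] at hij
    exact absurd hij (lt_irrefl _)
  · exact absurd hij (not_lt_of_gt (h j i h1))

theorem contains_p1342_iff {n : ℕ} {π : Perm (Fin n)} :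
    Contains p1342 π ↔ ∃ i j k l, i < j ∧ j < k ∧ k < l ∧ π i < π l ∧ π l < π j ∧ π j < π k := by
  constructor
  · rintro ⟨g, hg⟩
    refine ⟨g 0, g 1, g 2, g 3, ?_, ?_, ?_, ?_, ?_, ?_⟩
    · exact g.strictMono (by decide)
    · exact g.strictMono (by decide)
    · exact g.strictMono (by decide)
    · exact (hg 0 3).2 (by decide)
    · exact (hg 3 1).2 (by decide)
    · exact (hg 1 2).2 (by decide)
  · rintro ⟨i, j, k, l, hij, hjk, hkl, h1, h2, h3⟩
    refine contains_of_strictMono ![i, j, k, l] ?_ ?_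
    · rw [Fin.strictMono_iff_lt_succ]
      intro x
      fin_cases x <;> assumption
    · intro x y
      fin_cases x <;> fin_cases y <;> simp [p1342] <;> order

theorem contains_p1324_iff {n : ℕ} {π : Perm (Fin n)} :
    Contains p1324 π ↔ ∃ i j k l, i < j ∧ j < k ∧ k < l ∧ π i < π k ∧ π k < π j ∧ π j < π l := by
  constructor
  · rintro ⟨g, hg⟩
    refine ⟨g 0, g 1, g 2, g 3, ?_, ?_, ?_, ?_, ?_, ?_⟩
    · exact g.strictMono (by decide)
    · exact g.strictMono (by decide)
    · exact g.strictMono (by decide)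
    · exact (hg 0 2).2 (by decide)
    · exact (hg 2 1).2 (by decide)
    · exact (hg 1 3).2 (by decide)
  · rintro ⟨i, j, k, l, hij, hjk, hkl, h1, h2, h3⟩
    refine contains_of_strictMono ![i, j, k, l] ?_ ?_
    · rw [Fin.strictMono_iff_lt_succ]
      intro x
      fin_cases x <;> assumption
    · intro x y
      fin_cases x <;> fin_cases y <;> simp [p1324] <;> order

theorem avoids_p1342_iff {n : ℕ} {π : Perm (Fin n)} :
    Avoids p1342 π ↔ ∀ i j k l, i < j → j < k → k < l → π i < π l → π l < π j → ¬ π j < π k := by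
  simp only [Avoids, contains_p1342_iff]
  push Not
  rfl

theorem avoids_p1324_iff {n : ℕ} {π : Perm (Fin n)} :
    Avoids p1324 π ↔ ∀ i j k l, i < j → j < k → k < l → π i < π k → π k < π j → ¬ π j < π l := by
  simp only [Avoids, contains_p1324_iff]
  push Not
  rfl

theorem mem_Av_iff {n : ℕ} {π : Perm (Fin n)} :
    π ∈ Av n B1324_1342 ↔ Avoids p1324 π ∧ Avoids p1342 π := by
  simp [Av, B1324_1342]

theorem Avoids.p1324_inv {n : ℕ} {π : Perm (Fin n)} (h : Avoids p1324 π) : Avoids p1324 π⁻¹ := by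
  rw [avoids_p1324_iff] at h ⊢
  intro i j k l hij hjk hkl h1 h2 h3
  exact h _ _ _ _ h1 h2 h3 (by simpa using hij) (by simpa using hjk) (by simpa using hkl)

theorem Avoids.p1324_revCompl {n : ℕ} {π : Perm (Fin n)} (h : Avoids p1324 π) :
    Avoids p1324 (revCompl π) := by
  rw [avoids_p1324_iff] at h ⊢
  intro i j k l hij hjk hkl h1 h2 h3
  simp only [revCompl, Perm.mul_apply, Fin.revPerm_apply, Fin.rev_lt_rev] at h1 h2 h3
  exact h _ _ _ _ (Fin.rev_lt_rev.2 hkl) (Fin.rev_lt_rev.2 hjk) (Fin.rev_lt_rev.2 hij) h3 h2 h1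

/-! ### Inserting and deleting entries -/

theorem insertEntry_delete {n : ℕ} (π : Perm (Fin (n + 1))) (e : Fin (n + 1)) :
    insertEntry (delete π e) (π⁻¹ e) e = π := by
  ext1 p
  rcases Fin.eq_self_or_eq_succAbove (π⁻¹ e) p with rfl | ⟨j, rfl⟩
  · rw [insertEntry_self]; simp
  · rw [insertEntry_succAbove, succAbove_delete]; rfl

theorem insertEntry_inv {n : ℕ} (σ : Perm (Fin n)) (i v : Fin (n + 1)) :
    (insertEntry σ i v)⁻¹ = insertEntry σ⁻¹ v i := by
  ext1 p
  rw [Perm.inv_eq_iff_eq]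
  rcases Fin.eq_self_or_eq_succAbove v p with rfl | ⟨j, rfl⟩
  · rw [insertEntry_self, insertEntry_self]
  · rw [insertEntry_succAbove, insertEntry_succAbove]; simp

theorem revCompl_insertEntry {n : ℕ} (σ : Perm (Fin n)) (i v : Fin (n + 1)) :
    revCompl (insertEntry σ i v) = insertEntry (revCompl σ) i.rev v.rev := by
  ext1 p
  simp only [revCompl, Perm.mul_apply, Fin.revPerm_apply]
  rcases Fin.eq_self_or_eq_succAbove i.rev p with rfl | ⟨j, rfl⟩
  · rw [insertEntry_self, Fin.rev_rev, insertEntry_self]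
  · rw [insertEntry_succAbove, Fin.rev_succAbove, Fin.rev_rev, insertEntry_succAbove,
      Fin.rev_succAbove]
    simp

theorem revCompl_revCompl {n : ℕ} (π : Perm (Fin n)) : revCompl (revCompl π) = π := by
  ext1 p
  simp [revCompl]

theorem Avoids.of_insertEntry {m n : ℕ} {p : Perm (Fin m)} {σ : Perm (Fin n)} {i v : Fin (n + 1)}
    (h : Avoids p (insertEntry σ i v)) : Avoids p σ := by
  rintro ⟨g, hg⟩
  refine h ⟨g.trans (Fin.succAboveOrderEmb i), fun x y => ?_⟩
  rw [← hg]
  simp [insertEntry_succAbove]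

/-! ### Cuts -/

/-- The first `c` entries of `π` are its `c` smallest values. -/
def IsCut {n : ℕ} (π : Perm (Fin n)) (c : ℕ) : Prop :=
  ∀ i : Fin n, (i : ℕ) < c ↔ (π i : ℕ) < c

theorem isCut_of_mapsTo {n : ℕ} {π : Perm (Fin n)} {c : ℕ}
    (h : ∀ i : Fin n, (i : ℕ) < c → (π i : ℕ) < c) : IsCut π c := by
  have hs : Function.Bijective fun i : {i : Fin n // (i : ℕ) < c} =>
      (⟨π i, h i i.2⟩ : {i : Fin n // (i : ℕ) < c}) := by
    rw [← Finite.injective_iff_bijective]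
    intro x y hxy
    exact Subtype.ext (π.injective (congrArg Subtype.val hxy))
  refine fun i => ⟨h i, fun hi => ?_⟩
  obtain ⟨j, hj⟩ := hs.2 ⟨π i, hi⟩
  rw [← π.injective (congrArg Subtype.val hj)]
  exact j.2

theorem IsCut.inv {n : ℕ} {π : Perm (Fin n)} {c : ℕ} (h : IsCut π c) : IsCut π⁻¹ c := fun i => by
  rw [h (π⁻¹ i)]; simp

theorem IsCut.revCompl {n : ℕ} {π : Perm (Fin n)} {c : ℕ} (h : IsCut π c) (hc : c ≤ n) :
    IsCut (revCompl π) (n - c) := fun i => by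
  have := h i.rev
  simp only [PermPattern.revCompl, Perm.mul_apply, Fin.revPerm_apply, Fin.val_rev] at this ⊢
  omega

theorem castLen_apply_val {m n : ℕ} (h : m = n) (π : Perm (Fin m)) (i : Fin n) :
    (castLen h π i : ℕ) = π (i.cast h.symm) := rfl

theorem castLen_rfl {n : ℕ} (π : Perm (Fin n)) : castLen rfl π = π := rfl

theorem dsum_castAdd {m n : ℕ} (σ : Perm (Fin m)) (τ : Perm (Fin n)) (i : Fin m) :
    dsum σ τ (i.castAdd n) = (σ i).castAdd n := by
  simp [dsum, Equiv.permCongr_apply]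

theorem dsum_natAdd {m n : ℕ} (σ : Perm (Fin m)) (τ : Perm (Fin n)) (i : Fin n) :
    dsum σ τ (i.natAdd m) = (τ i).natAdd m := by
  simp [dsum, Equiv.permCongr_apply]

theorem isCut_dsum {m n : ℕ} (σ : Perm (Fin m)) (τ : Perm (Fin n)) : IsCut (dsum σ τ) m := by
  intro i
  induction i using Fin.addCases with
  | left i => simp [dsum_castAdd]
  | right i => simp [dsum_natAdd]

theorem IsCut.exists_dsum {m n : ℕ} {π : Perm (Fin (m + n))} (h : IsCut π m) :
    ∃ (σ : Perm (Fin m)) (τ : Perm (Fin n)), π = dsum σ τ := by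
  have : finSumFinEquiv.symm.permCongr π ∈ (Perm.sumCongrHom (Fin m) (Fin n)).range := by
    apply Perm.mem_sumCongrHom_range_of_perm_mapsTo_inl
    rintro _ ⟨i, rfl⟩
    have hi : (π (i.castAdd n) : ℕ) < m := (h _).1 (by simp)
    refine ⟨⟨_, hi⟩, ?_⟩
    simp only [Equiv.permCongr_apply, Equiv.symm_symm, finSumFinEquiv_apply_left]
    rw [Equiv.eq_symm_apply, finSumFinEquiv_apply_left]
    rfl
  obtain ⟨⟨σ, τ⟩, hστ⟩ := this
  refine ⟨σ, τ, ?_⟩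
  rw [dsum]
  have h2 := congrArg finSumFinEquiv.permCongr hστ
  rw [Perm.sumCongrHom_apply] at h2
  refine Eq.trans ?_ h2.symm
  ext1 x
  simp [Equiv.permCongr_apply]

theorem decomposable_iff {n : ℕ} {π : Perm (Fin n)} :
    Decomposable π ↔ ∃ c, 0 < c ∧ c < n ∧ IsCut π c := by
  constructor
  · rintro ⟨a, b, σ, τ, rfl, ha, hb, rfl⟩
    exact ⟨a, ha, by omega, isCut_dsum σ τ⟩
  · rintro ⟨c, h0, hc, h⟩
    obtain ⟨b, rfl⟩ := Nat.exists_eq_add_of_lt hc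
    obtain ⟨σ, τ, hστ⟩ := IsCut.exists_dsum (m := c) (n := b + 1) h
    exact ⟨c, b + 1, σ, τ, rfl, h0, by omega, hστ⟩

theorem Decomposable.inv {n : ℕ} {π : Perm (Fin n)} (h : Decomposable π) : Decomposable π⁻¹ := by
  rw [decomposable_iff] at h ⊢
  obtain ⟨c, h0, hc, h⟩ := h
  exact ⟨c, h0, hc, h.inv⟩

theorem Decomposable.revCompl {n : ℕ} {π : Perm (Fin n)} (h : Decomposable π) :
    Decomposable (revCompl π) := by
  rw [decomposable_iff] at h ⊢
  obtain ⟨c, h0, hc, h⟩ := h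
  exact ⟨n - c, by omega, by omega, h.revCompl hc.le⟩

/-! ### The map `fTilde` inserts a fixed point at a cut -/

theorem dsum_val_left {m n : ℕ} (σ : Perm (Fin m)) (τ : Perm (Fin n)) {i : Fin (m + n)} {k : Fin m}
    (h : (i : ℕ) = k) : (dsum σ τ i : ℕ) = σ k := by
  obtain rfl : i = k.castAdd n := Fin.ext h
  simp [dsum_castAdd]

theorem dsum_val_right {m n : ℕ} (σ : Perm (Fin m)) (τ : Perm (Fin n)) {i : Fin (m + n)} {k : Fin n}
    (h : (i : ℕ) = m + k) : (dsum σ τ i : ℕ) = m + τ k := by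
  obtain rfl : i = k.natAdd m := Fin.ext h
  simp [dsum_natAdd]

theorem isCut_dsum_left {m n d : ℕ} {σ : Perm (Fin m)} {τ : Perm (Fin n)} (hd : d ≤ m) :
    IsCut (dsum σ τ) d ↔ IsCut σ d := by
  refine ⟨fun h i => by simpa [dsum_castAdd] using h (i.castAdd n), fun h i => ?_⟩
  induction i using Fin.addCases with
  | left i => simpa [dsum_castAdd] using h i
  | right i =>
    simp only [dsum_natAdd, Fin.val_natAdd]
    omega

theorem isCut_dsum_right {m n d : ℕ} {σ : Perm (Fin m)} {τ : Perm (Fin n)} :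
    IsCut (dsum σ τ) (m + d) ↔ IsCut τ d := by
  refine ⟨fun h i => by simpa [dsum_natAdd] using h (i.natAdd m), fun h i => ?_⟩
  induction i using Fin.addCases with
  | left i =>
    simp only [dsum_castAdd, Fin.val_castAdd]
    omega
  | right i => simpa [dsum_natAdd] using h i

theorem eq_one_of_strictMono {n : ℕ} {π : Perm (Fin n)} (h : StrictMono π) : π = 1 := by
  have := (h.range_inj strictMono_id).1 (by simp)
  ext1 i
  exact congrFun this i

/-- The outer blocks are split off at the smallest and the largest proper cut, and this extremality
makes them indecomposable. A descent in the middle, with one entry from each outer block, would be a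
1324, so the middle is an identity. -/
theorem exists_isFTilde {n : ℕ} {π : Perm (Fin n)} (hav : Avoids p1324 π) (hd : Decomposable π) :
    ∃ ρ, IsFTilde π ρ := by
  classical
  rw [decomposable_iff] at hd
  obtain ⟨a, ⟨ha0, han, ha⟩, hmin⟩ : ∃ a, (0 < a ∧ a < n ∧ IsCut π a) ∧
      ∀ d, 0 < d → d < n → IsCut π d → a ≤ d :=
    ⟨Nat.find hd, Nat.find_spec hd, fun d h1 h2 h3 => Nat.find_min' hd ⟨h1, h2, h3⟩⟩
  have hd' : ∃ d, 0 < d ∧ d < n ∧ IsCut π (n - d) :=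
    ⟨n - a, by omega, by omega, by rwa [Nat.sub_sub_self han.le]⟩
  obtain ⟨b, ⟨hb0, hbn, hb⟩, hmax⟩ : ∃ b, (0 < b ∧ b < n ∧ IsCut π (n - b)) ∧
      ∀ d, 0 < d → d < n → IsCut π (n - d) → b ≤ d :=
    ⟨Nat.find hd', Nat.find_spec hd', fun d h1 h2 h3 => Nat.find_min' hd' ⟨h1, h2, h3⟩⟩
  have hab : a ≤ n - b := hmin _ (by omega) (by omega) hb
  obtain ⟨m, hm⟩ := Nat.exists_eq_add_of_le hab
  obtain rfl : n = a + m + b := by omega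
  rw [hm] at hb
  obtain ⟨β, τ, rfl⟩ := hb.exists_dsum
  rw [isCut_dsum_left (by omega)] at ha
  obtain ⟨σ, μ, rfl⟩ := ha.exists_dsum
  have hμ : μ = 1 := by
    refine eq_one_of_strictMono fun i j hij => ?_
    by_contra hlt
    have hlt : μ j < μ i :=
      lt_of_le_of_ne (not_lt.1 hlt) fun h => hij.ne' (μ.injective h)
    refine avoids_p1324_iff.1 hav (Fin.castAdd b (Fin.castAdd m ⟨0, ha0⟩))
      (Fin.castAdd b (Fin.natAdd a i)) (Fin.castAdd b (Fin.natAdd a j))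
      (Fin.natAdd (a + m) ⟨0, hb0⟩) ?_ ?_ ?_ ?_ ?_ ?_ <;>
    simp only [dsum_castAdd, dsum_natAdd, Fin.lt_def, Fin.val_castAdd, Fin.val_natAdd] at * <;>
    omega
  subst hμ
  refine ⟨_, a, m, b, σ, τ, rfl, by omega, ha0, hb0, ?_, ?_, rfl, rfl⟩
  · rw [decomposable_iff]
    rintro ⟨d, h1, h2, h3⟩
    have := hmin d h1 (by omega)
      ((isCut_dsum_left (by omega)).2 ((isCut_dsum_left (by omega)).2 h3))
    omega
  · rw [decomposable_iff]
    rintro ⟨d, h1, h2, h3⟩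
    have := hmax (b - d) (by omega) (by omega)
      (by rw [show a + m + b - (b - d) = a + m + d by omega]; exact isCut_dsum_right.2 h3)
    omega

theorem IsFTilde.exists_insertEntry {n : ℕ} {π : Perm (Fin n)} {ρ : Perm (Fin (n + 1))}
    (h : IsFTilde π ρ) :
    ∃ a : Fin (n + 1), 0 < (a : ℕ) ∧ (a : ℕ) < n ∧ IsCut π a ∧ ρ = insertEntry π a a := by
  obtain ⟨a, m, b, σ, τ, rfl, h', ha, hb, -, -, rfl, rfl⟩ := h
  refine ⟨⟨a, by omega⟩, ha, show a < a + m + b by omega,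
    (isCut_dsum_left (d := a) (by omega)).2 (isCut_dsum σ 1), ?_⟩
  rw [castLen_rfl]
  ext p
  rw [castLen_apply_val]
  rcases Fin.eq_self_or_eq_succAbove ⟨a, by omega⟩ p with rfl | ⟨j, rfl⟩
  · rw [insertEntry_self, dsum_val_left (k := Fin.natAdd a 0) _ _ (by simp),
      dsum_val_right (k := 0) _ _ (by simp)]
    simp
  · rw [insertEntry_succAbove]
    induction j using Fin.addCases with
    | left j =>
      induction j using Fin.addCases with
      | left j =>
        have h1 : (Fin.castAdd b (Fin.castAdd m j)).castSucc < ⟨a, by omega⟩ := by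
          simp [Fin.lt_def]
        have h2 : (Fin.castAdd b (Fin.castAdd m (σ j))).castSucc < ⟨a, by omega⟩ := by
          simp [Fin.lt_def]
        rw [dsum_castAdd, dsum_castAdd, Fin.succAbove_of_castSucc_lt _ _ h1,
          Fin.succAbove_of_castSucc_lt _ _ h2,
          dsum_val_left (k := Fin.castAdd (m + 1) j) _ _ (by simp),
          dsum_val_left (k := j) _ _ (by simp)]
        simp
      | right j =>
        have h1 : ⟨a, by omega⟩ ≤ (Fin.castAdd b (Fin.natAdd a j)).castSucc := by
          simp [Fin.le_def]
        rw [dsum_castAdd, dsum_natAdd, Perm.one_apply, Fin.succAbove_of_le_castSucc _ _ h1,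
          dsum_val_left (k := Fin.natAdd a j.succ) _ _ (by simp; omega),
          dsum_val_right (k := j.succ) _ _ (by simp)]
        simp; omega
    | right j =>
      have h1 : ⟨a, by omega⟩ ≤ (Fin.natAdd (a + m) j).castSucc := by
        simp [Fin.le_def]; omega
      have h2 : ⟨a, by omega⟩ ≤ (Fin.natAdd (a + m) (τ j)).castSucc := by
        simp [Fin.le_def]; omega
      rw [dsum_natAdd, Fin.succAbove_of_le_castSucc _ _ h1, Fin.succAbove_of_le_castSucc _ _ h2,
        dsum_val_right (k := j) _ _ (by simp; omega)]
      simp; omega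

/-- Uniqueness of the decomposition plays no role: whichever witness is chosen, a fixed point is
inserted at some proper cut, and this is all that later arguments use. -/
theorem exists_fTilde_eq {n : ℕ} {π : Perm (Fin n)} (hav : Avoids p1324 π) (hd : Decomposable π) :
    ∃ a : Fin (n + 1), 0 < (a : ℕ) ∧ (a : ℕ) < n ∧ IsCut π a ∧ fTilde π = insertEntry π a a := by
  have h := exists_isFTilde hav hd
  rw [fTilde, dif_pos h]
  exact h.choose_spec.exists_insertEntry

/-! ### Inserting an entry on the boundary of a `1342`-avoider -/

theorem insertEntry_lt_insertEntry {n : ℕ} (σ : Perm (Fin n)) (i v : Fin (n + 1)) (j k : Fin n) :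
    insertEntry σ i v (i.succAbove j) < insertEntry σ i v (i.succAbove k) ↔ σ j < σ k := by
  rw [insertEntry_succAbove, insertEntry_succAbove, Fin.succAbove_lt_succAbove_iff]

/-- A new copy of 1342 must use the new entry; `h1`, `h2`, `h3`, `h4` exclude it as the 1, 3, 4 and
2 respectively. -/
theorem avoids_p1342_insertEntry {n : ℕ} {σ : Perm (Fin n)} {i v : Fin (n + 1)}
    (hσ : Avoids p1342 σ)
    (h1 : ∀ j k l, i ≤ j.castSucc → j < k → k < l → v ≤ (σ l).castSucc → σ l < σ j → ¬ σ j < σ k)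
    (h2 : ∀ j k l, j.castSucc < i → i ≤ k.castSucc → k < l → σ j < σ l → (σ l).castSucc < v →
      ¬ v ≤ (σ k).castSucc)
    (h3 : ∀ j k l, j < k → k.castSucc < i → i ≤ l.castSucc → σ j < σ l → σ l < σ k →
      ¬ (σ k).castSucc < v)
    (h4 : ∀ j k l, j < k → k < l → l.castSucc < i → (σ j).castSucc < v → v ≤ (σ k).castSucc →
      ¬ σ k < σ l) :
    Avoids p1342 (insertEntry σ i v) := by
  rw [avoids_p1342_iff] at hσ ⊢
  intro a b c d hab hbc hcd had hdb hval_bc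
  have key : ∀ p, p = i ∨ ∃ j, p = i.succAbove j := Fin.eq_self_or_eq_succAbove i
  have e1 : ∀ j, i < i.succAbove j ↔ i ≤ j.castSucc := fun j =>
    Fin.lt_succAbove_iff_le_castSucc _ _
  have e2 : ∀ j, i.succAbove j < i ↔ j.castSucc < i := fun j =>
    Fin.succAbove_lt_iff_castSucc_lt _ _
  have e3 : ∀ j, v < v.succAbove j ↔ v ≤ j.castSucc := fun j =>
    Fin.lt_succAbove_iff_le_castSucc _ _
  have e4 : ∀ j, v.succAbove j < v ↔ j.castSucc < v := fun j =>
    Fin.succAbove_lt_iff_castSucc_lt _ _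
  rcases key a with rfl | ⟨a, rfl⟩ <;> rcases key b with rfl | ⟨b, rfl⟩ <;>
  rcases key c with rfl | ⟨c, rfl⟩ <;> rcases key d with rfl | ⟨d, rfl⟩ <;>
  simp only [insertEntry_self, insertEntry_succAbove, Fin.succAbove_lt_succAbove_iff, e1, e2, e3,
    e4, lt_irrefl] at hab hbc hcd had hdb hval_bc <;>
  try (exfalso; order)
  · exact h1 b c d hab hbc hcd had hdb hval_bc
  · exact h2 a c d hab hbc hcd had hdb hval_bc
  · exact h3 a b d hab hbc hcd had hdb hval_bc
  · exact h4 a b c hab hbc hcd had hdb hval_bc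
  · exact hσ a b c d hab hbc hcd had hdb hval_bc

/-! ### Inserting a fixed point at a cut -/

theorem val_succAbove {n : ℕ} (a : Fin (n + 1)) (j : Fin n) :
    ((a.succAbove j : ℕ) = j ∧ (j : ℕ) < a) ∨ ((a.succAbove j : ℕ) = j + 1 ∧ (a : ℕ) ≤ j) := by
  rcases lt_or_ge j.castSucc a with h | h
  · exact Or.inl ⟨by rw [Fin.succAbove_of_castSucc_lt _ _ h]; rfl, h⟩
  · exact Or.inr ⟨by rw [Fin.succAbove_of_le_castSucc _ _ h]; rfl, h⟩

theorem IsCut.insertEntry {n : ℕ} {σ : Perm (Fin n)} {a : Fin (n + 1)} (h : IsCut σ a) :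
    IsCut (insertEntry σ a a) a := by
  intro p
  rcases Fin.eq_self_or_eq_succAbove a p with rfl | ⟨j, rfl⟩
  · rw [insertEntry_self]
  · rw [insertEntry_succAbove]
    have := h j
    have := val_succAbove a j
    have := val_succAbove a (σ j)
    omega

theorem IsCut.insertEntry_succ {n : ℕ} {σ : Perm (Fin n)} {a : Fin (n + 1)} (h : IsCut σ a) :
    IsCut (PermPattern.insertEntry σ a a) (a + 1) := by
  intro p
  rcases Fin.eq_self_or_eq_succAbove a p with rfl | ⟨j, rfl⟩
  · rw [insertEntry_self]
  · rw [insertEntry_succAbove]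
    have := h j
    have := val_succAbove a j
    have := val_succAbove a (σ j)
    omega

/-- The first entry lies in front of the cut and would serve as the 1 of a 1342. -/
theorem no_231_after_cut {n : ℕ} {σ : Perm (Fin n)} {a : ℕ} (hσ : Avoids p1342 σ) (ha : 0 < a)
    (h : IsCut σ a) {j k l : Fin n} (hj : a ≤ j) (hjk : j < k) (hkl : k < l)
    (h1 : σ l < σ j) : ¬ σ j < σ k := by
  have hn : 0 < n := by omega
  have h0 := h ⟨0, hn⟩
  have hl := h l
  refine avoids_p1342_iff.1 hσ ⟨0, hn⟩ j k l ?_ hjk hkl ?_ h1 <;>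
  simp only [Fin.lt_def] at * <;> omega

/-- The entry at position a lies above the cut and would serve as the 4 of a 1324. -/
theorem no_132_before_cut {n : ℕ} {σ : Perm (Fin n)} {a : ℕ} (hσ : Avoids p1324 σ) (ha : a < n)
    (h : IsCut σ a) {j k l : Fin n} (hl : (l : ℕ) < a) (hjk : j < k) (hkl : k < l)
    (h1 : σ j < σ l) : ¬ σ l < σ k := by
  intro h2
  have h0 := h ⟨a, ha⟩
  have hk := h k
  refine avoids_p1324_iff.1 hσ j k l ⟨a, ha⟩ hjk hkl ?_ h1 h2 ?_ <;>
  simp only [Fin.lt_def] at * <;> omega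

theorem no_231_after_fixed {n : ℕ} {σ : Perm (Fin n)} {a : Fin (n + 1)} (hσ : Avoids p1342 σ)
    (ha : 0 < (a : ℕ)) (h : IsCut σ a) {j k l : Fin (n + 1)} (hj : (a : ℕ) < j) (hjk : j < k)
    (hkl : k < l) (h1 : insertEntry σ a a l < insertEntry σ a a j) :
    ¬ insertEntry σ a a j < insertEntry σ a a k := by
  obtain rfl | ⟨j, rfl⟩ := Fin.eq_self_or_eq_succAbove a j
  · omega
  obtain rfl | ⟨k, rfl⟩ := Fin.eq_self_or_eq_succAbove a k
  · simp only [Fin.lt_def] at *; omega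
  obtain rfl | ⟨l, rfl⟩ := Fin.eq_self_or_eq_succAbove a l
  · simp only [Fin.lt_def] at *; omega
  rw [insertEntry_lt_insertEntry] at h1 ⊢
  rw [Fin.succAbove_lt_succAbove_iff] at hjk hkl
  refine no_231_after_cut hσ ha h ?_ hjk hkl h1
  have := val_succAbove a j
  omega

theorem no_132_before_fixed {n : ℕ} {σ : Perm (Fin n)} {a : Fin (n + 1)} (hσ : Avoids p1324 σ)
    (ha : (a : ℕ) < n) (h : IsCut σ a) {j k l : Fin (n + 1)} (hl : (l : ℕ) < a) (hjk : j < k)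
    (hkl : k < l) (h1 : insertEntry σ a a j < insertEntry σ a a l) :
    ¬ insertEntry σ a a l < insertEntry σ a a k := by
  obtain rfl | ⟨j, rfl⟩ := Fin.eq_self_or_eq_succAbove a j
  · simp only [Fin.lt_def] at *; omega
  obtain rfl | ⟨k, rfl⟩ := Fin.eq_self_or_eq_succAbove a k
  · simp only [Fin.lt_def] at *; omega
  obtain rfl | ⟨l, rfl⟩ := Fin.eq_self_or_eq_succAbove a l
  · omega
  rw [insertEntry_lt_insertEntry] at h1 ⊢
  rw [Fin.succAbove_lt_succAbove_iff] at hjk hkl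
  refine no_132_before_cut hσ ha h ?_ hjk hkl h1
  have := val_succAbove a l
  omega

/-- The 2, 3 and 4 of 1342 all lie in inversions, while a fixed point at a cut lies in none. Only
the role of the 1 needs an argument. -/
theorem avoids_p1342_insert_fixed {n : ℕ} {σ : Perm (Fin n)} {a : Fin (n + 1)}
    (hσ : Avoids p1342 σ) (ha : 0 < (a : ℕ)) (h : IsCut σ a) :
    Avoids p1342 (insertEntry σ a a) := by
  apply avoids_p1342_insertEntry hσ
  · intro j k l hj hjk hkl _ h1
    exact no_231_after_cut hσ ha h hj hjk hkl h1
  · intro j k l _ hk hkl _ hl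
    have := h l
    simp only [Fin.lt_def, Fin.le_def, Fin.val_castSucc] at *
    omega
  · intro j k l _ _ hl _ hlk hk
    have := h l
    simp only [Fin.lt_def, Fin.le_def, Fin.val_castSucc] at *
    omega
  · intro j k l _ hkl hl _ hk
    have := h k
    simp only [Fin.lt_def, Fin.le_def, Fin.val_castSucc] at *
    omega

/-! ### Reinserting an entry on the boundary -/

/-- A first entry `v` above the cut. -/
theorem avoids_p1342_insert_first {n : ℕ} {σ : Perm (Fin n)} {a : Fin (n + 1)} {v : Fin (n + 2)}
    (hσ : Avoids p1342 σ) (ha : 0 < (a : ℕ)) (h : IsCut σ a) (hv : (a : ℕ) < v) :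
    Avoids p1342 (insertEntry (insertEntry σ a a) 0 v) := by
  apply avoids_p1342_insertEntry (avoids_p1342_insert_fixed hσ ha h)
  · intro j k l _ hjk hkl hl h1
    refine no_231_after_fixed hσ ha h ?_ hjk hkl h1
    -- After the insertion a + 1 is a cut as well, so entries with value above a stand strictly
    -- behind the fixed point.
    have := h.insertEntry_succ j
    simp only [Fin.lt_def, Fin.le_def, Fin.val_castSucc] at *
    omega
  all_goals
    intros
    simp only [Fin.lt_def, Fin.le_def, Fin.val_castSucc, Fin.val_zero] at *
    omega

/-- A smallest entry behind the cut. -/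
theorem avoids_p1342_insert_min {n : ℕ} {σ : Perm (Fin n)} {a : Fin (n + 1)} {i : Fin (n + 2)}
    (hσ : Avoids p1342 σ) (ha : 0 < (a : ℕ)) (h : IsCut σ a) (hi : (a : ℕ) < i) :
    Avoids p1342 (insertEntry (insertEntry σ a a) i 0) := by
  apply avoids_p1342_insertEntry (avoids_p1342_insert_fixed hσ ha h)
  · intro j k l hj hjk hkl hl h1
    refine no_231_after_fixed hσ ha h ?_ hjk hkl h1
    simp only [Fin.le_def, Fin.val_castSucc] at *
    omega
  all_goals
    intros
    simp only [Fin.lt_def, Fin.le_def, Fin.val_castSucc, Fin.val_zero] at *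
    omega

/-- A largest entry in front of the cut. -/
theorem avoids_p1342_insert_max {n : ℕ} {σ : Perm (Fin n)} {a : Fin (n + 1)} {i : Fin (n + 2)}
    (hσ : Avoids p1342 σ) (hσ' : Avoids p1324 σ) (ha : 0 < (a : ℕ)) (han : (a : ℕ) < n)
    (h : IsCut σ a) (hi : (i : ℕ) ≤ a) :
    Avoids p1342 (insertEntry (insertEntry σ a a) i (Fin.last _)) := by
  have hlast : ∀ x : Fin (n + 1), ¬ Fin.last (n + 1) ≤ x.castSucc := fun x => by
    simp only [Fin.le_def, Fin.val_last, Fin.val_castSucc]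
    omega
  apply avoids_p1342_insertEntry (avoids_p1342_insert_fixed hσ ha h)
  · intro j k l _ _ _ hl
    exact absurd hl (hlast _)
  · intro j k l _ _ _ _ _
    exact hlast _
  · intro j k l hjk hk hl hjl hlk
    -- With the maximum as the 4, the 3 stands in front of the cut. The 2 is smaller and hence in
    -- front of it too, which gives a 132 there.
    refine absurd hlk (no_132_before_fixed hσ' han h ?_ hjk ?_ hjl)
    · have := h.insertEntry k
      have := h.insertEntry l
      simp only [Fin.lt_def, Fin.le_def, Fin.val_castSucc] at *
      omega
    · simp only [Fin.lt_def, Fin.le_def, Fin.val_castSucc] at *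
      omega
  · intro j k l _ _ _ _ hk
    exact absurd hk (hlast _)

/-! ### Inversions -/

theorem inv_eq_sum {n : ℕ} (π : Perm (Fin n)) :
    inv π = ∑ i, ∑ j, if i < j ∧ π j < π i then 1 else 0 := by
  rw [inv, Finset.card_filter, ← Finset.univ_product_univ, Finset.sum_product]

theorem inv_insertEntry_zero {n : ℕ} (σ : Perm (Fin n)) (v : Fin (n + 1)) :
    inv (insertEntry σ 0 v) = v + inv σ := by
  have hs : ∀ j : Fin n, insertEntry σ 0 v j.succ = v.succAbove (σ j) := fun j => by
    rw [← Fin.zero_succAbove, insertEntry_succAbove]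
  rw [inv_eq_sum, inv_eq_sum, Fin.sum_univ_succ]
  congr 1
  · rw [Fin.sum_univ_succ]
    simp only [lt_irrefl, false_and, if_false, zero_add, Fin.succ_pos, true_and, hs,
      insertEntry_self, Fin.succAbove_lt_iff_castSucc_lt]
    rw [Equiv.sum_comp σ fun y => if y.castSucc < v then 1 else 0, ← Finset.card_filter]
    simp only [Fin.lt_def, Fin.val_castSucc]
    rw [Fin.card_filter_val_lt]
    omega
  · refine Finset.sum_congr rfl fun i _ => ?_
    rw [Fin.sum_univ_succ]
    simp [hs]

theorem inv_revCompl {n : ℕ} (π : Perm (Fin n)) : inv (revCompl π) = inv π := by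
  rw [inv_eq_sum, inv_eq_sum, Finset.sum_comm, ← Equiv.sum_comp Fin.revPerm]
  refine Finset.sum_congr rfl fun i _ => ?_
  rw [← Equiv.sum_comp Fin.revPerm]
  refine Finset.sum_congr rfl fun j _ => ?_
  simp [revCompl]

theorem inv_insertEntry_last {n : ℕ} (σ : Perm (Fin n)) (w : Fin (n + 1)) :
    inv (insertEntry σ (Fin.last n) w) = (n - w) + inv σ := by
  rw [← inv_revCompl, revCompl_insertEntry, Fin.rev_last, inv_insertEntry_zero, inv_revCompl,
    Fin.val_rev]
  omega

/-! ### Indecomposable one-entry extensions -/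

theorem IsCut.insertEntry_of_le {n : ℕ} {σ : Perm (Fin n)} {a : ℕ} {i v : Fin (n + 1)}
    (h : IsCut σ a) (hi : (i : ℕ) ≤ a) (hv : (v : ℕ) ≤ a) :
    IsCut (PermPattern.insertEntry σ i v) (a + 1) := by
  intro p
  rcases Fin.eq_self_or_eq_succAbove i p with rfl | ⟨j, rfl⟩
  · rw [insertEntry_self]; omega
  · rw [insertEntry_succAbove]
    have := h j
    have := val_succAbove i j
    have := val_succAbove v (σ j)
    omega

theorem IsCut.insertEntry_of_ge {n : ℕ} {σ : Perm (Fin n)} {a : ℕ} {i v : Fin (n + 1)}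
    (h : IsCut σ a) (hi : a ≤ (i : ℕ)) (hv : a ≤ (v : ℕ)) :
    IsCut (PermPattern.insertEntry σ i v) a := by
  intro p
  rcases Fin.eq_self_or_eq_succAbove i p with rfl | ⟨j, rfl⟩
  · rw [insertEntry_self]; omega
  · rw [insertEntry_succAbove]
    have := h j
    have := val_succAbove i j
    have := val_succAbove v (σ j)
    omega

/-- An inserted entry that stays on one side of the cut only enlarges a block. Indecomposability
therefore forces it to cross the cut. -/
theorem IsCut.lt_of_indecomposable {n : ℕ} {σ : Perm (Fin n)} {a : ℕ} {i v : Fin (n + 1)}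
    (h : IsCut σ a) (ha : a < n) (hind : ¬ Decomposable (PermPattern.insertEntry σ i v))
    (hi : (i : ℕ) ≤ a) : a < v := by
  by_contra hv
  exact hind (decomposable_iff.2 ⟨a + 1, by omega, by omega, h.insertEntry_of_le hi (by omega)⟩)

theorem IsCut.gt_of_indecomposable {n : ℕ} {σ : Perm (Fin n)} {a : ℕ} {i v : Fin (n + 1)}
    (h : IsCut σ a) (ha0 : 0 < a) (ha : a < n)
    (hind : ¬ Decomposable (PermPattern.insertEntry σ i v)) (hi : a ≤ i) : v < a := by
  by_contra hv
  exact hind (decomposable_iff.2 ⟨a, ha0, by omega, h.insertEntry_of_ge hi (by omega)⟩)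

/-! ### Appending a last entry below the cut -/

/-- If `σ` consists of `a` small entries followed by larger ones, and the small entries can be
separated into values `≥ w` followed by values `< w`, with the larger entries decreasing, then `σ`
has many inversions. -/
theorem le_inv_of_blocks {n a w : ℕ} {σ : Perm (Fin n)} (ha : a < n) (hw : w < a) (h : IsCut σ a)
    (hAB : ∀ x y : Fin n, (σ y : ℕ) < w → w ≤ (σ x : ℕ) → (x : ℕ) < a → x < y)
    (hT : ∀ x y : Fin n, a ≤ (x : ℕ) → x < y → σ y < σ x) :
    (a - w) * w + (n - 1 - a) ≤ inv σ := by
  let W : Fin n := ⟨w, by omega⟩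
  let A : Fin n := ⟨a, ha⟩
  let s : Finset (Fin n × Fin n) :=
    ((Finset.Ico W A).map σ⁻¹.toEmbedding) ×ˢ ((Finset.Iio W).map σ⁻¹.toEmbedding)
  -- Of the decreasing tail, only the inversions of its first entry are counted.
  let t : Finset (Fin n × Fin n) := {A} ×ˢ Finset.Ioi A
  have hs : s.card = (a - w) * w := by
    simp [s, W, A]
  have ht : t.card = n - 1 - a := by
    simp [t, A]
  have hmem : ∀ p, p ∈ s ↔ (w ≤ (σ p.1 : ℕ) ∧ (σ p.1 : ℕ) < a) ∧ (σ p.2 : ℕ) < w := by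
    intro p
    simp only [s, Finset.mem_product, Finset.mem_map_equiv, Finset.mem_Ico, Finset.mem_Iio,
      Fin.le_def, Fin.lt_def]
    rfl
  have hdisj : Disjoint s t := by
    rw [Finset.disjoint_left]
    intro p hp hp'
    rw [hmem, ← h] at hp
    simp only [t, Finset.mem_product, Finset.mem_singleton] at hp'
    have : (p.1 : ℕ) = a := congrArg Fin.val hp'.1
    omega
  rw [← hs, ← ht, ← Finset.card_union_of_disjoint hdisj]
  apply Finset.card_le_card
  intro p hp
  rw [Finset.mem_filter]
  refine ⟨Finset.mem_univ _, ?_⟩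
  rcases Finset.mem_union.1 hp with hp | hp
  · rw [hmem, ← h] at hp
    exact ⟨hAB _ _ hp.2 hp.1.1 hp.1.2, Fin.lt_def.2 (by omega)⟩
  · simp only [t, Finset.mem_product, Finset.mem_singleton, Finset.mem_Ioi] at hp
    obtain ⟨h1, h2⟩ := hp
    rw [← h1] at h2
    exact ⟨h2, hT _ _ (by rw [h1]) h2⟩

/-- Here the first entry is the only one in front of the cut with value at least w; once it is
deleted, the next w entries are exactly the values below w. -/
theorem decomposable_delete_first {n w : ℕ} {σ : Perm (Fin n)} {v : Fin (n + 1)} (hv : (v : ℕ) = w)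
    (hw0 : 0 < w) (hw : w + 1 < n) (h : IsCut σ (w + 1))
    (h0 : ∀ x : Fin n, (x : ℕ) = 0 → (σ x : ℕ) = w) :
    Decomposable (delete (insertEntry σ (Fin.last n) v) (insertEntry σ (Fin.last n) v 0)) := by
  set π := insertEntry σ (Fin.last n) v with hπ
  have hval : ∀ x : Fin n, π x.castSucc = v.succAbove (σ x) := fun x => by
    rw [← Fin.succAbove_last_apply, hπ, insertEntry_succAbove]
  have hpi0 : (π 0 : ℕ) = w + 1 := by
    have h1 := hval ⟨0, by omega⟩
    have h2 := h0 ⟨0, by omega⟩ rfl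
    have h3 := val_succAbove v (σ ⟨0, by omega⟩)
    rw [← h1] at h3
    change ((π 0 : ℕ) = _ ∧ _) ∨ ((π 0 : ℕ) = _ ∧ _) at h3
    omega
  refine decomposable_iff.2 ⟨w, hw0, by omega, isCut_of_mapsTo fun i hi => ?_⟩
  have h1 := succAbove_delete π (π 0) i
  rw [Equiv.symm_apply_apply, Fin.zero_succAbove] at h1
  have h2 := hval ⟨i + 1, by omega⟩
  have h3 : (⟨i + 1, by omega⟩ : Fin n).castSucc = i.succ := rfl
  rw [h3, ← h1] at h2
  have h4 := val_succAbove (π 0) (delete π (π 0) i)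
  have h5 := val_succAbove v (σ ⟨i + 1, by omega⟩)
  have h6 := (h ⟨i + 1, by omega⟩).1 (by simp; omega)
  have h7 : (σ ⟨i + 1, by omega⟩ : ℕ) ≠ w := by
    intro h7
    have h8 : σ ⟨i + 1, by omega⟩ = σ ⟨0, by omega⟩ := Fin.ext (h7.trans (h0 _ rfl).symm)
    simpa using σ.injective h8
  rw [← h2] at h5
  omega

/-- With the last entry as the 2 of a potential 1342, avoidance forces the block structure of
`le_inv_of_blocks`. Its inversions and those of the last entry together exceed the bound. -/
theorem lt_inv_insertEntry_last {n a : ℕ} {σ : Perm (Fin n)} {v : Fin (n + 1)} (ha : a < n)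
    (h : IsCut σ a) (hv0 : 0 < (v : ℕ)) (hva : (v : ℕ) < a)
    (hav : Avoids p1342 (insertEntry σ (Fin.last n) v))
    (hind : ¬ Decomposable
      (delete (insertEntry σ (Fin.last n) v) (insertEntry σ (Fin.last n) v 0))) :
    2 * n - 4 < inv (insertEntry σ (Fin.last n) v) := by
  have hval : ∀ x : Fin n, insertEntry σ (Fin.last n) v x.castSucc = v.succAbove (σ x) := by
    intro x
    rw [← Fin.succAbove_last_apply, insertEntry_succAbove]
  have hfree : ∀ x y z : Fin n, (σ x : ℕ) < v → (v : ℕ) ≤ σ y → x < y → y < z → ¬ σ y < σ z := by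
    intro x y z hx hy hxy hyz hyz'
    refine avoids_p1342_iff.1 hav x.castSucc y.castSucc z.castSucc (Fin.last n) hxy hyz
      (Fin.castSucc_lt_last z) ?_ ?_ ?_
    · rw [hval, insertEntry_self, Fin.succAbove_lt_iff_castSucc_lt]
      exact hx
    · rw [hval, insertEntry_self, Fin.lt_succAbove_iff_le_castSucc]
      exact hy
    · rwa [hval, hval, Fin.succAbove_lt_succAbove_iff]
  have hAB : ∀ x y : Fin n, (σ y : ℕ) < v → (v : ℕ) ≤ (σ x : ℕ) → (x : ℕ) < a → x < y := by
    intro x y hy hx hxa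
    by_contra hxy
    have hne : y ≠ x := by rintro rfl; omega
    have h1 := h ⟨a, ha⟩
    have h2 := h x
    exact hfree y x ⟨a, ha⟩ hy hx (lt_of_le_of_ne (not_lt.1 hxy) hne) hxa
      (Fin.lt_def.2 (by simp only at h1; omega))
  have hT : ∀ x y : Fin n, a ≤ (x : ℕ) → x < y → σ y < σ x := by
    intro x y hx hxy
    obtain ⟨b, hb⟩ := σ.surjective ⟨0, by omega⟩
    have hb0 : (σ b : ℕ) = 0 := congrArg Fin.val hb
    have h1 := h b
    have h2 := h x
    have h3 := hfree b x y (by omega) (by omega) (Fin.lt_def.2 (by omega)) hxy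
    exact lt_of_le_of_ne (not_lt.1 h3) fun h4 => hxy.ne' (σ.injective h4)
  -- If a = v + 1, the value v is the only one in the upper block, so it stands first and deleting
  -- the first entry of the extended permutation would leave a decomposable one.
  have ha2 : (v : ℕ) + 2 ≤ a := by
    by_contra hlt
    obtain rfl : a = v + 1 := by omega
    refine hind (decomposable_delete_first rfl hv0 ha h fun x hx => ?_)
    have h1 := h x
    obtain ⟨c, hc⟩ := σ.surjective ⟨v, by omega⟩
    have hc0 : (σ c : ℕ) = v := congrArg Fin.val hc
    have h2 := h c
    by_contra hne
    have h3 := hAB c x (by omega) (by omega) (by omega)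
    simp only [Fin.lt_def] at h3
    omega
  have hle := le_inv_of_blocks ha hva h hAB hT
  rw [inv_insertEntry_last]
  -- With a = v + 2 + α and v = u + 1, the lower bound (n - v) + (a - v)v + (n - 1 - a) equals 2n -
  -- 3 + αu.
  obtain ⟨α, rfl⟩ := Nat.exists_eq_add_of_le ha2
  obtain ⟨u, hu⟩ := Nat.exists_eq_add_of_lt hv0
  have e1 : (v : ℕ) + 2 + α - v = 2 + α := by omega
  rw [e1] at hle
  have e2 : (2 + α) * (v : ℕ) = 2 * v + α * u + α := by rw [hu]; ring
  have e3 := Nat.zero_le (α * u)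
  omega

/-! ### The map `f` preserves the avoidance of `1342` -/

theorem decomposable_revCompl_iff {n : ℕ} {π : Perm (Fin n)} :
    Decomposable (revCompl π) ↔ Decomposable π :=
  ⟨fun h => by simpa [revCompl_revCompl] using h.revCompl, Decomposable.revCompl⟩

theorem exists_fFirst_insertEntry_eq {n : ℕ} {σ : Perm (Fin n)} (v : Fin (n + 1))
    (hav : Avoids p1324 σ) (hd : Decomposable σ) :
    ∃ a : Fin (n + 1), 0 < (a : ℕ) ∧ (a : ℕ) < n ∧ IsCut σ a ∧
      fFirst (insertEntry σ 0 v) = insertEntry (insertEntry σ a a) 0 v.castSucc := by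
  obtain ⟨a, h0, hn, ha, h⟩ := exists_fTilde_eq hav hd
  refine ⟨a, h0, hn, ha, ?_⟩
  rw [fFirst, insertEntry_self, delete_insertEntry, h]

theorem exists_fFirst_inv_insertEntry_eq {n : ℕ} {σ : Perm (Fin n)} (i : Fin (n + 1))
    (hav : Avoids p1324 σ) (hd : Decomposable σ) :
    ∃ a : Fin (n + 1), 0 < (a : ℕ) ∧ (a : ℕ) < n ∧ IsCut σ a ∧
      (fFirst (insertEntry σ i 0)⁻¹)⁻¹ = insertEntry (insertEntry σ a a) i.castSucc 0 := by
  obtain ⟨a, h0, hn, ha, h⟩ := exists_fFirst_insertEntry_eq i hav.p1324_inv hd.inv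
  refine ⟨a, h0, hn, by simpa using ha.inv, ?_⟩
  rw [insertEntry_inv, h, insertEntry_inv, insertEntry_inv, inv_inv]

theorem avoids_p1342_f {n : ℕ} {π : Perm (Fin n)} (hπ : π ∈ Av n B1324_1342)
    (hd : Decomposable π ∨ AlmostDecomposable π) (hinv : (inv π : ℤ) ≤ 2 * (n : ℤ) - 6) :
    Avoids p1342 (f π) := by
  obtain ⟨h1324, h1342⟩ := mem_Av_iff.1 hπ
  rcases n with _ | n
  · rcases hd with hd | hd
    · obtain ⟨c, _, hc, _⟩ := decomposable_iff.1 hd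
      omega
    · exact hd.elim
  by_cases hdec : Decomposable π
  · obtain ⟨a, h0, hn, ha, h⟩ := exists_fTilde_eq h1324 hdec
    rw [f, if_pos hdec, h]
    exact avoids_p1342_insert_fixed h1342 h0 ha
  obtain ⟨-, e, he, hde⟩ := hd.resolve_left hdec
  rw [f, if_neg hdec]
  by_cases hfirst : Decomposable (delete π (π 0))
  · rw [if_pos (Or.inl hfirst), fFirstTwo, if_pos hfirst]
    obtain ⟨σ, v, rfl⟩ : ∃ σ v, π = insertEntry σ 0 v :=
      ⟨_, _, by simpa using (insertEntry_delete π (π 0)).symm⟩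
    rw [insertEntry_self, delete_insertEntry] at hfirst
    obtain ⟨a, h0, hn, ha, h⟩ := exists_fFirst_insertEntry_eq v h1324.of_insertEntry hfirst
    rw [h]
    exact avoids_p1342_insert_first h1342.of_insertEntry h0 ha
      (ha.lt_of_indecomposable hn hdec (Nat.zero_le _))
  by_cases hmin : Decomposable (delete π 0)
  · rw [if_pos (Or.inr hmin), fFirstTwo, if_neg hfirst]
    obtain ⟨σ, i, rfl⟩ : ∃ σ i, π = insertEntry σ i 0 := ⟨_, _, (insertEntry_delete π 0).symm⟩
    rw [delete_insertEntry] at hmin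
    obtain ⟨a, h0, hn, ha, h⟩ := exists_fFirst_inv_insertEntry_eq i h1324.of_insertEntry hmin
    rw [h]
    refine avoids_p1342_insert_min h1342.of_insertEntry h0 ha ?_
    by_contra hi
    exact absurd (ha.lt_of_indecomposable hn hdec (not_lt.1 hi)) (by simp)
  rw [if_neg (not_or.2 ⟨hfirst, hmin⟩)]
  have hlast : ¬ Decomposable (delete π (π (Fin.last n))) := by
    intro hlast
    obtain ⟨σ, v, rfl⟩ : ∃ σ v, π = insertEntry σ (Fin.last n) v :=
      ⟨_, _, by simpa using (insertEntry_delete π (π (Fin.last n))).symm⟩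
    rw [insertEntry_self, delete_insertEntry] at hlast
    have hv : (v : ℕ) ≠ 0 := by
      intro hv
      obtain rfl : v = 0 := Fin.ext hv
      rw [delete_insertEntry] at hmin
      exact hmin hlast
    obtain ⟨a, h0, hn, ha⟩ := decomposable_iff.1 hlast
    have hva := ha.gt_of_indecomposable h0 hn hdec (by simpa using hn.le)
    -- Here π has length n + 1, so the assumed bound is 2(n + 1) - 6 = 2n - 4.
    have := lt_inv_insertEntry_last hn ha (Nat.pos_of_ne_zero hv) hva h1342 hfirst
    push_cast at hinv
    omega
  have hmax : Decomposable (delete π (Fin.last n)) := by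
    rcases he with rfl | rfl | rfl | rfl
    · exact absurd hde hmin
    · exact absurd hde hfirst
    · exact hde
    · exact absurd hde hlast
  -- The first entry of the reverse-complement comes from the last entry of π, so the rule for a
  -- smallest entry applies there.
  have hlast' : ¬ Decomposable (delete (revCompl π) (revCompl π 0)) := by
    obtain ⟨σ, v, rfl⟩ : ∃ σ v, π = insertEntry σ (Fin.last n) v :=
      ⟨_, _, by simpa using (insertEntry_delete π (π (Fin.last n))).symm⟩
    rw [insertEntry_self, delete_insertEntry] at hlast
    rwa [revCompl_insertEntry, Fin.rev_last, insertEntry_self, delete_insertEntry,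
      decomposable_revCompl_iff]
  rw [fFirstTwo, if_neg hlast']
  obtain ⟨σ, i, rfl⟩ : ∃ σ i, π = insertEntry σ i (Fin.last n) :=
    ⟨_, _, (insertEntry_delete π (Fin.last n)).symm⟩
  rw [delete_insertEntry] at hmax
  obtain ⟨a, h0, hn, ha, h⟩ := exists_fFirst_inv_insertEntry_eq i.rev
    h1324.of_insertEntry.p1324_revCompl hmax.revCompl
  have ha' : IsCut σ (a.rev : ℕ) := by
    have := ha.revCompl hn.le
    rw [revCompl_revCompl] at this
    rw [Fin.val_rev]
    convert this using 1
    omega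
  have ea : (a.rev : ℕ) = n - a := by rw [Fin.val_rev]; omega
  rw [revCompl_insertEntry, Fin.rev_last, h, revCompl_insertEntry, revCompl_insertEntry,
    revCompl_revCompl, Fin.rev_zero, Fin.rev_castSucc, Fin.rev_rev]
  refine avoids_p1342_insert_max h1342.of_insertEntry h1324.of_insertEntry (by omega) (by omega)
    ha' ?_
  -- Under reverse-complement it is the distance of the maximum from the right end that f preserves,
  -- so its position grows to i + 1; what remains is i < n - a, that is, the maximum crosses the
  -- cut.
  rw [Fin.val_succ, Nat.succ_le_iff]
  by_contra hi
  have := ha'.gt_of_indecomposable (by omega) (by omega) hdec (not_lt.1 hi)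
  rw [Fin.val_last] at this
  omega

/-! ### Counting avoiders by their first entry -/

/-- No entry `≥ c` of `π` is followed by both a smaller and a larger entry `≥ c`: the entries `≥ c`
avoid `213` and `231`. -/
def AvoidsAbove {n : ℕ} (c : ℕ) (π : Perm (Fin n)) : Prop :=
  ∀ i j k, i < j → i < k → c ≤ (π j : ℕ) → π j < π i → ¬ π i < π k

theorem AvoidsAbove.mono {n c d : ℕ} {π : Perm (Fin n)} (h : AvoidsAbove c π) (hcd : c ≤ d) :
    AvoidsAbove d π :=
  fun i j k hij hik hj => h i j k hij hik (hcd.trans hj)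

/-- The two patterns are 1 ⊕ 213 and 1 ⊕ 231. The order of j and k is left open, which covers both
at once. -/
theorem mem_Av_iff_avoidsAbove {n : ℕ} {π : Perm (Fin n)} :
    π ∈ Av n B1324_1342 ↔
      ∀ l i j k, l < i → i < j → i < k → π l < π j → π j < π i → ¬ π i < π k := by
  rw [mem_Av_iff, avoids_p1324_iff, avoids_p1342_iff]
  constructor
  · rintro ⟨h1, h2⟩ l i j k hli hij hik hlj hji hik'
    rcases lt_trichotomy j k with h | rfl | h
    · exact h1 l i j k hli hij h hlj hji hik'
    · exact lt_asymm hji hik'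
    · exact h2 l i k j hli hik h hlj hji hik'
  · intro h
    exact ⟨fun a b c d hab hbc hcd => h a b c d hab hbc (hbc.trans hcd),
      fun a b c d hab hbc hcd => h a b d c hab (hbc.trans hcd) hbc⟩

theorem insertEntry_zero_succ {n : ℕ} (σ : Perm (Fin n)) (v : Fin (n + 1)) (j : Fin n) :
    insertEntry σ 0 v j.succ = v.succAbove (σ j) := by
  rw [← Fin.zero_succAbove, insertEntry_succAbove]

theorem insertEntry_zero_mem_Av_iff {n : ℕ} {σ : Perm (Fin n)} {v : Fin (n + 1)} :
    insertEntry σ 0 v ∈ Av (n + 1) B1324_1342 ↔ σ ∈ Av n B1324_1342 ∧ AvoidsAbove v σ := by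
  constructor
  · intro h
    refine ⟨?_, ?_⟩
    · rw [mem_Av_iff] at h ⊢
      exact ⟨h.1.of_insertEntry, h.2.of_insertEntry⟩
    · rw [mem_Av_iff_avoidsAbove] at h
      intro i j k hij hik hj hji hik'
      refine h 0 i.succ j.succ k.succ (Fin.succ_pos i) (Fin.succ_lt_succ_iff.2 hij)
        (Fin.succ_lt_succ_iff.2 hik) ?_ ?_ ?_
      · rw [insertEntry_self, insertEntry_zero_succ, Fin.lt_succAbove_iff_le_castSucc]
        exact hj
      · simpa [insertEntry_zero_succ] using hji
      · simpa [insertEntry_zero_succ] using hik'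
  · rintro ⟨h1, h2⟩
    rw [mem_Av_iff_avoidsAbove] at h1 ⊢
    intro l i j k hli hij hik
    obtain ⟨i, rfl⟩ := Fin.exists_succ_eq.2 (Fin.ne_zero_of_lt hli)
    obtain ⟨j, rfl⟩ := Fin.exists_succ_eq.2 (Fin.ne_zero_of_lt hij)
    obtain ⟨k, rfl⟩ := Fin.exists_succ_eq.2 (Fin.ne_zero_of_lt hik)
    rw [Fin.succ_lt_succ_iff] at hij hik
    simp only [insertEntry_zero_succ, Fin.succAbove_lt_succAbove_iff]
    induction l using Fin.cases with
    | zero =>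
      rw [insertEntry_self, Fin.lt_succAbove_iff_le_castSucc]
      exact h2 i j k hij hik
    | succ l =>
      rw [insertEntry_zero_succ, Fin.succAbove_lt_succAbove_iff]
      exact h1 l i j k (Fin.succ_lt_succ_iff.1 hli) hij hik

/-- `π` avoids `1324` and `1342`, and its entries `≥ c` avoid `213` and `231`. -/
def AvoidsBoth {n : ℕ} (c : ℕ) (π : Perm (Fin n)) : Prop :=
  π ∈ Av n B1324_1342 ∧ AvoidsAbove c π

/-- The first entry v already imposes the condition on all entries above v, which subsumes the one
for c. -/
theorem avoidsBoth_insertEntry_of_le {n c : ℕ} {σ : Perm (Fin n)} {v : Fin (n + 1)}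
    (hv : (v : ℕ) ≤ c) :
    AvoidsBoth c (insertEntry σ 0 v) ↔ AvoidsBoth v σ := by
  rw [AvoidsBoth, AvoidsBoth, insertEntry_zero_mem_Av_iff]
  refine ⟨And.left, fun h => ⟨h, ?_⟩⟩
  intro i j k hij hik hj hji
  obtain ⟨j, rfl⟩ := Fin.exists_succ_eq.2 (Fin.ne_zero_of_lt hij)
  obtain ⟨k, rfl⟩ := Fin.exists_succ_eq.2 (Fin.ne_zero_of_lt hik)
  rw [insertEntry_zero_succ] at hj hji ⊢
  have hvj := val_succAbove v (σ j)
  induction i using Fin.cases with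
  | zero =>
    rw [insertEntry_self, Fin.lt_def] at hji
    omega
  | succ i =>
    rw [insertEntry_zero_succ, Fin.succAbove_lt_succAbove_iff] at hji ⊢
    refine h.2 i j k (Fin.succ_lt_succ_iff.1 hij) (Fin.succ_lt_succ_iff.1 hik) ?_ hji
    omega

theorem avoidsBoth_insertEntry_of_gt {n c : ℕ} {σ : Perm (Fin n)} {v : Fin (n + 1)}
    (hv : c < (v : ℕ)) :
    AvoidsBoth c (insertEntry σ 0 v) ↔ (v : ℕ) = n ∧ AvoidsBoth c σ := by
  rw [AvoidsBoth, AvoidsBoth, insertEntry_zero_mem_Av_iff]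
  constructor
  · rintro ⟨⟨h1, -⟩, h2⟩
    refine ⟨?_, h1, ?_⟩
    -- A first entry strictly between c and the maximum is followed by both the value c and the
    -- value v + 1.
    · by_contra hne
      obtain ⟨j, hj⟩ := σ.surjective ⟨c, by omega⟩
      obtain ⟨k, hk⟩ := σ.surjective ⟨v, by omega⟩
      have hj' : (σ j : ℕ) = c := congrArg Fin.val hj
      have hk' : (σ k : ℕ) = v := congrArg Fin.val hk
      have hvj := val_succAbove v (σ j)
      have hvk := val_succAbove v (σ k)
      refine h2 0 j.succ k.succ (Fin.succ_pos j) (Fin.succ_pos k) ?_ ?_ ?_ <;>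
      simp only [insertEntry_zero_succ, insertEntry_self, Fin.lt_def] <;> omega
    · intro i j k hij hik hj hji hik'
      refine h2 i.succ j.succ k.succ (Fin.succ_lt_succ_iff.2 hij) (Fin.succ_lt_succ_iff.2 hik)
        ?_ ?_ ?_
      · have hvj := val_succAbove v (σ j)
        rw [insertEntry_zero_succ]
        omega
      · simpa [insertEntry_zero_succ] using hji
      · simpa [insertEntry_zero_succ] using hik'
  · rintro ⟨hvn, h1, h2⟩
    refine ⟨⟨h1, h2.mono hv.le⟩, ?_⟩
    intro i j k hij hik hj hji
    obtain ⟨j, rfl⟩ := Fin.exists_succ_eq.2 (Fin.ne_zero_of_lt hij)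
    obtain ⟨k, rfl⟩ := Fin.exists_succ_eq.2 (Fin.ne_zero_of_lt hik)
    have hvj := val_succAbove v (σ j)
    rw [insertEntry_zero_succ] at hj hji ⊢
    induction i using Fin.cases with
    | zero =>
      rw [insertEntry_self, Fin.lt_def]
      omega
    | succ i =>
      rw [insertEntry_zero_succ, Fin.succAbove_lt_succAbove_iff] at hji ⊢
      refine h2 i j k (Fin.succ_lt_succ_iff.1 hij) (Fin.succ_lt_succ_iff.1 hik) ?_ hji
      omega

open Classical in
/-- The number of permutations with `k` inversions that satisfy `AvoidsBoth c`. -/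
noncomputable def avAbove (n c : ℕ) (k : ℤ) : ℕ :=
  (Finset.univ.filter fun π : Perm (Fin n) => AvoidsBoth c π ∧ (inv π : ℤ) = k).card

/-- A permutation is determined by its first entry and the remaining ones. -/
def insertFirst (n : ℕ) : Fin (n + 1) × Perm (Fin n) ≃ Perm (Fin (n + 1)) where
  toFun p := insertEntry p.2 0 p.1
  invFun π := (π 0, delete π (π 0))
  left_inv p := by simp [insertEntry_self, delete_insertEntry]
  right_inv π := by simpa using insertEntry_delete π (π 0)

/-- A first entry i contributes i inversions. Taking k in ℤ lets k - i become negative, where the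
count is zero, instead of being truncated. -/
theorem avAbove_succ (n c : ℕ) (k : ℤ) :
    avAbove (n + 1) c k = ∑ i ∈ Finset.range (n + 1),
      if i ≤ c then avAbove n i (k - i) else if i = n then avAbove n c (k - n) else 0 := by
  classical
  rw [← Fin.sum_univ_eq_sum_range fun i =>
    if i ≤ c then avAbove n i (k - i) else if i = n then avAbove n c (k - n) else 0,
    avAbove, Finset.card_filter, ← Equiv.sum_comp (insertFirst n), ← Finset.univ_product_univ,
    Finset.sum_product]
  refine Finset.sum_congr rfl fun v _ => ?_
  simp only [insertFirst, Equiv.coe_fn_mk, inv_insertEntry_zero]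
  rw [← Finset.card_filter]
  split_ifs with h1 h2
  · simp only [avoidsBoth_insertEntry_of_le h1, avAbove]
    congr 1
    ext σ
    simp only [Finset.mem_filter, Finset.mem_univ, true_and]
    push_cast
    refine and_congr_right fun _ => ?_
    omega
  · simp only [avoidsBoth_insertEntry_of_gt (not_le.1 h1), avAbove]
    congr 1
    ext σ
    simp only [Finset.mem_filter, Finset.mem_univ, true_and, h2]
    push_cast
    refine and_congr_right fun _ => ?_
    omega
  · simp [avoidsBoth_insertEntry_of_gt (not_le.1 h1), h2]

theorem avAbove_succ_of_lt {n c : ℕ} (hc : c < n) (k : ℤ) :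
    avAbove (n + 1) c k =
      ∑ i ∈ Finset.range (c + 1), avAbove n i (k - i) + avAbove n c (k - n) := by
  rw [avAbove_succ, Finset.sum_range_succ, if_neg (by omega), if_pos rfl]
  congr 1
  rw [← Finset.sum_subset (Finset.range_subset_range.2 (show c + 1 ≤ n by omega))]
  · refine Finset.sum_congr rfl fun i hi => if_pos ?_
    rw [Finset.mem_range] at hi
    omega
  · intro i hi hi'
    rw [Finset.mem_range] at hi hi'
    rw [if_neg (by omega), if_neg (by omega)]

theorem avAbove_succ_of_ge {n c : ℕ} (hc : n ≤ c) (k : ℤ) :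
    avAbove (n + 1) c k = ∑ i ∈ Finset.range (n + 1), avAbove n i (k - i) := by
  rw [avAbove_succ]
  refine Finset.sum_congr rfl fun i hi => if_pos ?_
  rw [Finset.mem_range] at hi
  omega

/-- In terms of generating functions, `(1 + q ^ (n + 1)) * F (n + 1) c ≤ F (n + 2) c`. -/
theorem avAbove_add_le (n : ℕ) : ∀ c ≤ n + 1, ∀ k : ℤ,
    avAbove (n + 1) c k + avAbove (n + 1) c (k - (n + 1 : ℕ)) ≤ avAbove (n + 2) c k := by
  induction n with
  | zero =>
    have h1 : ∀ k, avAbove 1 1 k = avAbove 1 0 k := fun k => by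
      rw [avAbove_succ_of_ge (by omega), avAbove_succ_of_ge (by omega)]
    intro c hc k
    rcases Nat.le_one_iff_eq_zero_or_eq_one.1 hc with rfl | rfl
    · rw [avAbove_succ_of_lt (n := 1) (by omega)]
      simp
    · rw [avAbove_succ_of_ge (n := 1) le_rfl, Finset.sum_range_succ]
      simp [h1]
  | succ n ih =>
    have mono : ∀ m ≤ n + 2, ∀ k : ℤ, ∑ i ∈ Finset.range m, avAbove (n + 1) i (k - i) ≤
        ∑ i ∈ Finset.range m, avAbove (n + 2) i (k - i) := fun m hm k =>
      Finset.sum_le_sum fun i hi =>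
        (Nat.le_add_right _ _).trans (ih i (by rw [Finset.mem_range] at hi; omega) _)
    intro c hc k
    rcases Nat.lt_or_ge c (n + 2) with hlt | hge
    · rw [avAbove_succ_of_lt (n := n + 2) hlt]
      -- The term q^(n+2) F(n+2, c) cancels, leaving F(n+2, c) ≤ Σ_{i ≤ c} q^i F(n+2, i).
      refine Nat.add_le_add_right ?_ _
      rcases Nat.lt_or_ge c (n + 1) with hlt' | hge'
      -- The same inequality one length lower: it is the induction hypothesis with q^(n+1) F(n+1, c)
      -- cancelled. It bounds the extra term of the recursion, so that a factor 1 + q^(n+1) can be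
      -- pulled out and absorbed termwise.
      · have hE : ∀ k : ℤ, avAbove (n + 1) c k ≤
            ∑ i ∈ Finset.range (c + 1), avAbove (n + 1) i (k - i) := fun k => by
          have := ih c (by omega) k
          rw [avAbove_succ_of_lt (n := n + 1) hlt'] at this
          omega
        calc avAbove (n + 2) c k
            = ∑ i ∈ Finset.range (c + 1), avAbove (n + 1) i (k - i) +
                avAbove (n + 1) c (k - (n + 1 : ℕ)) := avAbove_succ_of_lt hlt' k
          _ ≤ ∑ i ∈ Finset.range (c + 1), avAbove (n + 1) i (k - i) +
                ∑ i ∈ Finset.range (c + 1), avAbove (n + 1) i (k - (n + 1 : ℕ) - i) :=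
              Nat.add_le_add_left (hE _) _
          _ = ∑ i ∈ Finset.range (c + 1), (avAbove (n + 1) i (k - i) +
                avAbove (n + 1) i (k - i - (n + 1 : ℕ))) := by
              rw [Finset.sum_add_distrib]
              simp only [sub_right_comm]
          _ ≤ _ := Finset.sum_le_sum fun i hi =>
              ih i (by rw [Finset.mem_range] at hi; omega) _
      · obtain rfl : c = n + 1 := by omega
        rw [avAbove_succ_of_ge (n := n + 1) le_rfl]
        exact mono _ le_rfl k
    · obtain rfl : c = n + 2 := by omega
      rw [avAbove_succ_of_ge (n := n + 2) le_rfl, Finset.sum_range_succ,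
        avAbove_succ_of_ge (n := n + 1) (c := n + 2) (by omega) k]
      exact Nat.add_le_add_right (mono _ le_rfl k) _

theorem av_eq_avAbove {n c : ℕ} (hc : n ≤ c) (k : ℕ) : av n k B1324_1342 = avAbove n c k := by
  classical
  rw [av, avAbove, ← Set.ncard_coe_finset]
  congr 1
  ext π
  have hA : AvoidsAbove c π := fun i j k _ _ hj => by omega
  simp [AvoidsBoth, hA]

theorem av_le_av_succ (n k : ℕ) :
    av (n + 1) k B1324_1342 ≤ av (n + 2) k B1324_1342 := by
  -- `avAbove_add_le` compares both lengths at the same c = n + 1. In length n + 2 this is still the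
  -- full count, since only one value is ≥ n + 1.
  have h : avAbove (n + 2) (n + 1) k = avAbove (n + 2) (n + 2) k := by
    rw [avAbove_succ_of_ge le_rfl, avAbove_succ_of_ge (by omega)]
  rw [av_eq_avAbove le_rfl, av_eq_avAbove le_rfl, ← h]
  exact (Nat.le_add_right _ _).trans (avAbove_add_le n (n + 1) le_rfl k)

end PermPattern

theorem theorem6p9 :
    (∀ (n : ℕ) (π : Equiv.Perm (Fin n)),
      π ∈ PermPattern.Av n PermPattern.B1324_1342 →
      (PermPattern.Decomposable π ∨ PermPattern.AlmostDecomposable π) →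
      (PermPattern.inv π : ℤ) ≤ 2 * (n : ℤ) - 6 →
      PermPattern.Avoids PermPattern.p1342 (PermPattern.f π)) ∧
    (∀ n k : ℕ, ((k : ℚ) + 7) / 2 ≤ (n : ℚ) →
      PermPattern.av n k PermPattern.B1324_1342 ≤
        PermPattern.av (n + 1) k PermPattern.B1324_1342) := by
  refine ⟨fun n π => PermPattern.avoids_p1342_f, fun n k h => ?_⟩
  rcases n with _ | n
  -- The bound n ≥ (k + 7)/2 excludes n = 0; the recursive inequality starts at length 1.
  · have : (0 : ℚ) ≤ k := Nat.cast_nonneg k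
    rw [Nat.cast_zero] at h
    linarith
  · exact PermPattern.av_le_av_succ n k
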